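/- Let $(M,\omega)$ be a smooth (Hausdorff, second countable) symplectic manifold of dimension $2n\ge 2$, and let $G$ be a compact Lie group acting smoothly on $M$ from the left by symplectomorphisms. For $h\in G$ let $h_*:T_pM\to T_{h\cdot p}M$ be the tangent map of the action of $h$. An almost complex structure $J$ on $M$ is called compatible with $\omega$ if $\omega(J\cdot,J\cdot)=\omega$ and $g_J:=\omega(J\cdot,\cdot)$ is a Riemannian metric. Let $Fr^u_J\to M$ be its unitary frame bundle: the points over $p$ are the $g_J$-orthonormal bases $(u_1,\dots,u_n,v_1,\dots,v_n)$ of $T_pM$ with $v_i=Ju_i$, and $C=A+iB\in U(n)$ acts on them from the right by multiplication with $\begin{pmatrix}A&-B\\B&A\end{pmatrix}$. The Maslov $S^1$ bundle is $\pi:\Gamma_J=Fr^u_J/SU(n)\to M$, with the principal $S^1$-action $[f]\cdot z:=[f\cdot C]$ for any $C\in U(n)$ with $\det_{\mathbb C}C=z$. Let $J$ be a compatible almost complex structure, let $\bar J$ be a compatible almost complex structure that is $G$-equivariant ($h_*\circ\bar J=\bar J\circ h_*$ for all $h\in G$), and let $\Psi:(TM,\omega,J)\to(TM,\omega,\bar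 J)$ be a unitary bundle isomorphism over the identity of $M$ (for example $J=\bar J$ and $\Psi=\mathrm{id}$). The lifted $G$-action on $\Gamma_J$ is the action induced by the action of $h\in G$ on frames $f=(u_i,v_i)$ through $\Psi^{-1}\circ h_*\circ\Psi$ (so through $h_*$ if $\Psi=\mathrm{id}$); it covers the action on $M$ and commutes with the $S^1$-action. Denote by $G_p$ the isotropy group of $p\in M$ in $G$, which is a closed subgroup of $G$, and by $G_w$ the isotropy group of $w\in\Gamma_J$ under the lifted action. Then there is a family of Lie group homomorphisms $\phi_p:G_p\to S^1$, $p\in M$, such that for every $p\in M$ and every $w\in\pi^{-1}(p)$ $$h\cdot w=w\cdot\phi_p(h)\quad\text{for all }h\in G_p,\qquad\text{and}\qquad \ker\phi_p=G_w$$ (in particular $G_w$ is the same group for all $w\in\pi^{-1}(p)$). Moreover, for all $p\in M$ and $h'\in G$, $$\phi_{h'\cdot p}\circ \mathrm{Ad}_{h'}=\phi_p,$$ where $\mathrm{Ad}_{h'}:G_p\to G_{h'\cdot p}$ is $h\mapsto h'hh'^{-1}$. -/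

import Mathlib

open scoped Manifold ContDiff

noncomputable section

namespace Maslov

/-! ### Symplectic manifolds and compatible almost complex structures

Manifolds of dimension `2 * n` are charted on `EuclideanSpace ℝ (Fin (2 * n))`. -/

section Symplectic

variable {n : ℕ} {M : Type*} [TopologicalSpace M]
  [ChartedSpace (EuclideanSpace ℝ (Fin (2 * n))) M]

/-- The expression of a field of 2-forms in the preferred chart around `x`: its pullback by the
inverse of the chart (meaningful on the target of the chart). -/
def chartForm (form : ∀ p : M, (TangentSpace (𝓡 (2 * n)) p) [⋀^Fin 2]→L[ℝ] ℝ) (x : M) :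
    EuclideanSpace ℝ (Fin (2 * n)) → (EuclideanSpace ℝ (Fin (2 * n))) [⋀^Fin 2]→L[ℝ] ℝ :=
  fun y => (form ((chartAt (EuclideanSpace ℝ (Fin (2 * n))) x).symm y)).compContinuousLinearMap
    (mfderiv (𝓡 (2 * n)) (𝓡 (2 * n)) (chartAt (EuclideanSpace ℝ (Fin (2 * n))) x).symm y)

variable (n M) in
/-- A symplectic form: a smooth, closed, nondegenerate 2-form. -/
structure SymplecticForm where
  form : ∀ p : M, (TangentSpace (𝓡 (2 * n)) p) [⋀^Fin 2]→L[ℝ] ℝ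
  smooth : ∀ x : M, ContDiffOn ℝ ∞ (chartForm form x)
    (chartAt (EuclideanSpace ℝ (Fin (2 * n))) x).target
  closed : ∀ x : M, ∀ y ∈ (chartAt (EuclideanSpace ℝ (Fin (2 * n))) x).target,
    extDeriv (chartForm form x) y = 0
  nondegenerate : ∀ (p : M) (u : TangentSpace (𝓡 (2 * n)) p),
    (∀ v : TangentSpace (𝓡 (2 * n)) p, form p ![u, v] = 0) → u = 0

/-- The symplectic form at a point, as a bilinear map. -/
def SymplecticForm.bilin (Ω : SymplecticForm n M) (p : M) :
    TangentSpace (𝓡 (2 * n)) p →ₗ[ℝ] TangentSpace (𝓡 (2 * n)) p →ₗ[ℝ] ℝ :=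
  LinearMap.mk₂ ℝ (fun u v => Ω.form p ![u, v])
    (fun a b c => (Ω.form p).toMultilinearMap.cons_add ![c] a b)
    (fun r a c => (Ω.form p).toMultilinearMap.cons_smul ![c] r a)
    (fun c a b => by
      have e : ∀ x, Function.update ![c, 0] 1 x = ![c, x] := fun x => by
        funext i; fin_cases i <;> simp
      have h := (Ω.form p).toMultilinearMap.map_update_add ![c, 0] 1 a b
      rw [e, e, e] at h
      exact h)
    (fun r c a => by
      have e : ∀ x, Function.update ![c, 0] 1 x = ![c, x] := fun x => by
        funext i; fin_cases i <;> simp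
      have h := (Ω.form p).toMultilinearMap.map_update_smul ![c, 0] 1 r a
      rw [e, e] at h
      exact h)

theorem SymplecticForm.bilin_apply (Ω : SymplecticForm n M) (p : M)
    (u v : TangentSpace (𝓡 (2 * n)) p) : Ω.bilin p u v = Ω.form p ![u, v] := rfl

theorem SymplecticForm.bilin_swap (Ω : SymplecticForm n M) (p : M)
    (u v : TangentSpace (𝓡 (2 * n)) p) : Ω.bilin p u v = - Ω.bilin p v u := by
  have h := (Ω.form p).toAlternatingMap.map_swap ![v, u] (i := 0) (j := 1) (by decide)
  have e : (![v, u] ∘ Equiv.swap (0 : Fin 2) 1) = ![u, v] := by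
    funext i; fin_cases i <;> simp
  rw [e] at h
  exact h

variable [IsManifold (𝓡 (2 * n)) ∞ M]

/-- An almost complex structure `J` compatible with `Ω`: a smooth bundle endomorphism with
`J² = -1`, preserving `Ω`, such that `Ω (J ·, ·)` is positive definite. -/
structure CompatibleACS (Ω : SymplecticForm n M) where
  toMap : ∀ p : M, TangentSpace (𝓡 (2 * n)) p →L[ℝ] TangentSpace (𝓡 (2 * n)) p
  smooth : ContMDiff (𝓡 (2 * n)).tangent (𝓡 (2 * n)).tangent ∞
    (fun x : TangentBundle (𝓡 (2 * n)) M =>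
      (⟨x.1, toMap x.1 x.2⟩ : TangentBundle (𝓡 (2 * n)) M))
  sq : ∀ (p : M) (u : TangentSpace (𝓡 (2 * n)) p), toMap p (toMap p u) = -u
  preserves : ∀ (p : M) (u v : TangentSpace (𝓡 (2 * n)) p),
    Ω.form p ![toMap p u, toMap p v] = Ω.form p ![u, v]
  pos : ∀ (p : M) (u : TangentSpace (𝓡 (2 * n)) p), u ≠ 0 → 0 < Ω.form p ![toMap p u, u]

variable {Ω : SymplecticForm n M}

/-- The Riemannian metric `g_J = Ω (J ·, ·)`. -/
def CompatibleACS.metric (J : CompatibleACS Ω) (p : M) :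
    TangentSpace (𝓡 (2 * n)) p →ₗ[ℝ] TangentSpace (𝓡 (2 * n)) p →ₗ[ℝ] ℝ :=
  (Ω.bilin p).comp (J.toMap p).toLinearMap

theorem CompatibleACS.metric_apply (J : CompatibleACS Ω) (p : M)
    (u v : TangentSpace (𝓡 (2 * n)) p) : J.metric p u v = Ω.form p ![J.toMap p u, v] := rfl

theorem CompatibleACS.metric_J_J (J : CompatibleACS Ω) (p : M)
    (u v : TangentSpace (𝓡 (2 * n)) p) :
    J.metric p (J.toMap p u) (J.toMap p v) = J.metric p u v :=
  J.preserves p (J.toMap p u) v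

theorem CompatibleACS.metric_symm (J : CompatibleACS Ω) (p : M)
    (u v : TangentSpace (𝓡 (2 * n)) p) : J.metric p u v = J.metric p v u := by
  change Ω.bilin p (J.toMap p u) v = Ω.bilin p (J.toMap p v) u
  have h := J.preserves p (J.toMap p u) v
  rw [J.sq] at h
  rw [Ω.bilin_swap p (J.toMap p v) u]
  change Ω.bilin p (-u) (J.toMap p v) = Ω.bilin p (J.toMap p u) v at h
  rw [← h]; simp

/-! ### The unitary frame bundle and the Maslov circle bundle -/

/-- A point of the unitary frame bundle: a base point `p` and a `g_J`-orthonormal basis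
`(u₁, …, uₙ, v₁, …, vₙ)` of the tangent space at `p` with `vᵢ = J uᵢ`. -/
structure UnitaryFrame (J : CompatibleACS Ω) where
  base : M
  u : Fin n → TangentSpace (𝓡 (2 * n)) base
  v : Fin n → TangentSpace (𝓡 (2 * n)) base
  v_eq : ∀ i, v i = J.toMap base (u i)
  metric_uu : ∀ i j, J.metric base (u i) (u j) = if i = j then 1 else 0
  metric_uv : ∀ i j, J.metric base (u i) (v j) = 0
  metric_vv : ∀ i j, J.metric base (v i) (v j) = if i = j then 1 else 0

variable {J J' : CompatibleACS Ω}

/-- Tangent spaces at all points are the model space, so frames can be compared there. -/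
theorem UnitaryFrame.ext_model {f f' : UnitaryFrame J} (hb : f.base = f'.base)
    (hu : ∀ i, (show EuclideanSpace ℝ (Fin (2 * n)) from f.u i) =
      (show EuclideanSpace ℝ (Fin (2 * n)) from f'.u i)) : f = f' := by
  obtain ⟨b, u, v, hv, _, _, _⟩ := f
  obtain ⟨b', u', v', hv', _, _, _⟩ := f'
  obtain rfl : b = b' := hb
  obtain rfl : u = u' := funext hu
  obtain rfl : v = v' := funext fun i => (hv i).trans (hv' i).symm
  rfl

theorem UnitaryFrame.metric_sum (f : UnitaryFrame J) (a b c d : Fin n → ℝ) :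
    J.metric f.base (∑ i, (a i • f.u i + b i • f.v i)) (∑ i, (c i • f.u i + d i • f.v i)) =
      ∑ i, (a i * c i + b i * d i) := by
  have hvu : ∀ i j, J.metric f.base (f.v i) (f.u j) = 0 := fun i j => by
    rw [J.metric_symm, f.metric_uv]
  simp only [map_sum, map_add, map_smul, LinearMap.sum_apply, LinearMap.add_apply,
    LinearMap.smul_apply, f.metric_uu, f.metric_uv, f.metric_vv, hvu, smul_eq_mul]
  refine Finset.sum_congr rfl fun i _ => ?_
  simp [mul_comm]

theorem unitary_re {C : Matrix (Fin n) (Fin n) ℂ} (hC : C ∈ Matrix.unitaryGroup (Fin n) ℂ)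
    (j l : Fin n) :
    ∑ i, ((C i j).re * (C i l).re + (C i j).im * (C i l).im) = if j = l then 1 else 0 := by
  have h := congrArg Complex.re (congrFun (congrFun (Matrix.mem_unitaryGroup_iff'.1 hC) j) l)
  simpa [Matrix.mul_apply, Matrix.one_apply, Matrix.star_apply, apply_ite Complex.re] using h

theorem unitary_im {C : Matrix (Fin n) (Fin n) ℂ} (hC : C ∈ Matrix.unitaryGroup (Fin n) ℂ)
    (j l : Fin n) :
    ∑ i, ((C i j).re * -(C i l).im + (C i j).im * (C i l).re) = 0 := by
  have h := congrArg Complex.im (congrFun (congrFun (Matrix.mem_unitaryGroup_iff'.1 hC) j) l)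
  have h' : ∑ i, ((C i j).re * (C i l).im + -((C i j).im * (C i l).re)) = 0 := by
    simpa [Matrix.mul_apply, Matrix.one_apply, Matrix.star_apply, apply_ite Complex.im] using h
  rw [← neg_eq_zero, ← h', ← Finset.sum_neg_distrib]
  exact Finset.sum_congr rfl fun i _ => by ring

/-- The frame `(u, v) · C` for `C = A + iB` unitary, i.e. `(u, v)` times the real matrix with
block rows `(A, -B)` and `(B, A)`. -/
def UnitaryFrame.act (f : UnitaryFrame J) (C : Matrix.unitaryGroup (Fin n) ℂ) :
    UnitaryFrame J where
  base := f.base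
  u j := ∑ i, ((C.1 i j).re • f.u i + (C.1 i j).im • f.v i)
  v j := ∑ i, (-(C.1 i j).im • f.u i + (C.1 i j).re • f.v i)
  v_eq j := by
    simp only [map_sum, map_add, map_smul, f.v_eq, J.sq]
    refine Finset.sum_congr rfl fun i _ => ?_
    module
  metric_uu j l := by
    rw [f.metric_sum, unitary_re C.2]
  metric_uv j l := by
    rw [f.metric_sum, unitary_im C.2]
  metric_vv j l := by
    rw [f.metric_sum, ← unitary_re C.2]
    exact Finset.sum_congr rfl fun i _ => by ring

theorem UnitaryFrame.act_one (f : UnitaryFrame J) : f.act 1 = f := by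
  refine UnitaryFrame.ext_model rfl fun j => ?_
  change ∑ i : Fin n, _ = f.u j
  have : ∀ i, ((1 : Matrix (Fin n) (Fin n) ℂ) i j).re • f.u i +
      ((1 : Matrix (Fin n) (Fin n) ℂ) i j).im • f.v i = if i = j then f.u i else 0 := by
    intro i
    by_cases h : i = j <;> simp [Matrix.one_apply, h]
  exact (Finset.sum_congr rfl fun i _ => this i).trans (by simp)

theorem UnitaryFrame.act_mul (f : UnitaryFrame J) (C D : Matrix.unitaryGroup (Fin n) ℂ) :
    f.act (C * D) = (f.act C).act D := by
  refine UnitaryFrame.ext_model rfl fun j => ?_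
  change ∑ i, (((C.1 * D.1) i j).re • f.u i + ((C.1 * D.1) i j).im • f.v i) =
    ∑ k, ((D.1 k j).re • ∑ i, ((C.1 i k).re • f.u i + (C.1 i k).im • f.v i) +
      (D.1 k j).im • ∑ i, (-(C.1 i k).im • f.u i + (C.1 i k).re • f.v i))
  simp only [Finset.smul_sum, ← Finset.sum_add_distrib]
  rw [Finset.sum_comm]
  refine Finset.sum_congr rfl fun i _ => ?_
  simp only [Matrix.mul_apply, Complex.re_sum, Complex.im_sum, Finset.sum_smul,
    ← Finset.sum_add_distrib, Complex.mul_re, Complex.mul_im]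
  refine Finset.sum_congr rfl fun k _ => ?_
  module

/-- Two unitary frames are equivalent if they lie in the same `SU(n)`-orbit. -/
def suSetoid (J : CompatibleACS Ω) : Setoid (UnitaryFrame J) where
  r f f' := ∃ C : Matrix.unitaryGroup (Fin n) ℂ,
    C.1 ∈ Matrix.specialUnitaryGroup (Fin n) ℂ ∧ f' = f.act C
  iseqv := by
    refine ⟨fun f => ⟨1, one_mem (Matrix.specialUnitaryGroup (Fin n) ℂ), f.act_one.symm⟩, ?_, ?_⟩
    · rintro f _ ⟨C, hC, rfl⟩
      refine ⟨C⁻¹, Matrix.mem_specialUnitaryGroup_iff.2 ⟨C⁻¹.2, ?_⟩, ?_⟩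
      · rw [Matrix.UnitaryGroup.inv_val, Matrix.star_eq_conjTranspose,
          Matrix.det_conjTranspose, (Matrix.mem_specialUnitaryGroup_iff.1 hC).2, star_one]
      · rw [← UnitaryFrame.act_mul, mul_inv_cancel, UnitaryFrame.act_one]
    · rintro f _ _ ⟨C, hC, rfl⟩ ⟨D, hD, rfl⟩
      exact ⟨C * D, (Matrix.specialUnitaryGroup (Fin n) ℂ).mul_mem hC hD, (f.act_mul C D).symm⟩

/-- The Maslov circle bundle `Γ_J`: the unitary frame bundle modulo `SU(n)`. -/
def Gam (J : CompatibleACS Ω) : Type _ := Quotient (suSetoid J)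

/-- The class of a unitary frame. -/
def Gam.mk (f : UnitaryFrame J) : Gam J := Quotient.mk (suSetoid J) f

/-- The projection `Γ_J → M`. -/
def Gam.proj (w : Gam J) : M :=
  Quotient.lift (s := suSetoid J) (fun f => f.base) (by rintro f _ ⟨C, _, rfl⟩; rfl) w

theorem Gam.mk_eq_of_det_eq (f : UnitaryFrame J) {C D : Matrix.unitaryGroup (Fin n) ℂ}
    (h : C.1.det = D.1.det) : Gam.mk (f.act C) = Gam.mk (f.act D) := by
  refine Quotient.sound (s := suSetoid J) ⟨C⁻¹ * D, ?_, ?_⟩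
  · refine Matrix.mem_specialUnitaryGroup_iff.2 ⟨(C⁻¹ * D).2, ?_⟩
    change (C⁻¹.1 * D.1).det = 1
    rw [Matrix.det_mul, ← h, ← Matrix.det_mul]
    have : C⁻¹.1 * C.1 = 1 := congrArg Subtype.val (inv_mul_cancel C)
    rw [this, Matrix.det_one]
  · rw [← UnitaryFrame.act_mul, mul_inv_cancel_left]

/-- The matrix `diag (z, 1, …, 1)`, a unitary matrix of determinant `z`. -/
def circleUnitary [NeZero n] (z : Circle) : Matrix.unitaryGroup (Fin n) ℂ :=
  ⟨Matrix.diagonal fun i => if i = 0 then (z : ℂ) else 1, by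
    rw [Matrix.mem_unitaryGroup_iff, Matrix.star_eq_conjTranspose,
      Matrix.diagonal_conjTranspose, Matrix.diagonal_mul_diagonal, ← Matrix.diagonal_one]
    congr 1
    funext i
    by_cases h : i = 0 <;> simp [h, Complex.mul_conj]⟩

theorem det_circleUnitary [NeZero n] (z : Circle) :
    (circleUnitary (n := n) z).1.det = z := by
  simp [circleUnitary, Matrix.det_diagonal]

/-- The principal action of the circle on `Γ_J`: `[f] · z = [f · C]` for any unitary `C` of
determinant `z` (see `Gam.circleAct_mk`; here `C = diag (z, 1, …, 1)`). -/
def Gam.circleAct [NeZero n] (w : Gam J) (z : Circle) : Gam J :=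
  Quotient.lift (s := suSetoid J) (fun f => Gam.mk (f.act (circleUnitary z))) (by
    rintro f _ ⟨S, hS, rfl⟩
    rw [← UnitaryFrame.act_mul]
    refine Gam.mk_eq_of_det_eq f ?_
    change _ = (S.1 * (circleUnitary (n := n) z).1).det
    rw [Matrix.det_mul, (Matrix.mem_specialUnitaryGroup_iff.1 hS).2, one_mul]) w

theorem Gam.circleAct_mk [NeZero n] (f : UnitaryFrame J) (z : Circle)
    (C : Matrix.unitaryGroup (Fin n) ℂ) (hC : C.1.det = z) :
    (Gam.mk f).circleAct z = Gam.mk (f.act C) :=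
  Gam.mk_eq_of_det_eq f ((det_circleUnitary z).trans hC.symm)

/-- A unitary isomorphism from `(TM, Ω, J)` to `(TM, Ω, J')`: a smooth family of linear
automorphisms of the tangent spaces that preserve `Ω` and intertwine `J` with `J'`. -/
structure UnitaryIso (J J' : CompatibleACS Ω) where
  toEquiv : ∀ p : M, TangentSpace (𝓡 (2 * n)) p ≃L[ℝ] TangentSpace (𝓡 (2 * n)) p
  smooth : ContMDiff (𝓡 (2 * n)).tangent (𝓡 (2 * n)).tangent ∞
    (fun x : TangentBundle (𝓡 (2 * n)) M =>
      (⟨x.1, toEquiv x.1 x.2⟩ : TangentBundle (𝓡 (2 * n)) M))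
  map_form : ∀ (p : M) (u v : TangentSpace (𝓡 (2 * n)) p),
    Ω.form p ![toEquiv p u, toEquiv p v] = Ω.form p ![u, v]
  map_J : ∀ (p : M) (u : TangentSpace (𝓡 (2 * n)) p),
    toEquiv p (J.toMap p u) = J'.toMap p (toEquiv p u)

theorem UnitaryIso.symm_J (Ψ : UnitaryIso J J') (p : M) (u : TangentSpace (𝓡 (2 * n)) p) :
    (Ψ.toEquiv p).symm (J'.toMap p u) = J.toMap p ((Ψ.toEquiv p).symm u) := by
  rw [ContinuousLinearEquiv.symm_apply_eq, Ψ.map_J, ContinuousLinearEquiv.apply_symm_apply]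

theorem UnitaryIso.symm_form (Ψ : UnitaryIso J J') (p : M)
    (u v : TangentSpace (𝓡 (2 * n)) p) :
    Ω.form p ![(Ψ.toEquiv p).symm u, (Ψ.toEquiv p).symm v] = Ω.form p ![u, v] := by
  rw [← Ψ.map_form, ContinuousLinearEquiv.apply_symm_apply,
    ContinuousLinearEquiv.apply_symm_apply]

variable (J) in
/-- The identity, as a unitary isomorphism. -/
def UnitaryIso.refl : UnitaryIso J J where
  toEquiv _ := ContinuousLinearEquiv.refl ℝ _
  smooth := contMDiff_id
  map_form _ _ _ := rfl
  map_J _ _ := rfl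

/-! ### Symplectic actions and their lifts -/

section Action

variable {G : Type*} [Group G] [MulAction G M]

variable (n) in
/-- The pushforward `h_*` of tangent vectors by the action of a group element. -/
def push (h : G) (p : M) :
    TangentSpace (𝓡 (2 * n)) p →L[ℝ] TangentSpace (𝓡 (2 * n)) (h • p) :=
  mfderiv (𝓡 (2 * n)) (𝓡 (2 * n)) (fun x : M => h • x) p

variable (G) in
/-- The action of `G` is by symplectic diffeomorphisms: each `h` acts smoothly and preserves
`Ω`. -/
structure IsSymplecticAction (Ω : SymplecticForm n M) : Prop where
  smooth : ∀ h : G, ContMDiff (𝓡 (2 * n)) (𝓡 (2 * n)) ∞ fun x : M => h • x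
  preserves : ∀ (h : G) (p : M) (u v : TangentSpace (𝓡 (2 * n)) p),
    Ω.form (h • p) ![push n h p u, push n h p v] = Ω.form p ![u, v]

variable (G) in
/-- `J` is `G`-equivariant: `h_* ∘ J = J ∘ h_*` for all `h`. -/
def CompatibleACS.IsEquivariant (J : CompatibleACS Ω) : Prop :=
  ∀ (h : G) (p : M) (u : TangentSpace (𝓡 (2 * n)) p),
    push n h p (J.toMap p u) = J.toMap (h • p) (push n h p u)

/-- The lift of `h` to tangent vectors: `h_*` conjugated by a unitary isomorphism `Ψ`; it is
`h_*` itself if `Ψ` is the identity. -/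
def UnitaryIso.lift (Ψ : UnitaryIso J J') (h : G) (p : M) :
    TangentSpace (𝓡 (2 * n)) p →L[ℝ] TangentSpace (𝓡 (2 * n)) (h • p) :=
  ((Ψ.toEquiv (h • p)).symm : TangentSpace (𝓡 (2 * n)) (h • p) →L[ℝ] _).comp
    ((push n h p).comp (Ψ.toEquiv p : TangentSpace (𝓡 (2 * n)) p →L[ℝ] _))

theorem UnitaryIso.lift_apply (Ψ : UnitaryIso J J') (h : G) (p : M)
    (u : TangentSpace (𝓡 (2 * n)) p) :
    Ψ.lift h p u = (Ψ.toEquiv (h • p)).symm (push n h p (Ψ.toEquiv p u)) := rfl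

theorem UnitaryIso.lift_J (Ψ : UnitaryIso J J') (hJ : J'.IsEquivariant G) (h : G) (p : M)
    (u : TangentSpace (𝓡 (2 * n)) p) :
    Ψ.lift h p (J.toMap p u) = J.toMap (h • p) (Ψ.lift h p u) := by
  rw [Ψ.lift_apply, Ψ.map_J, hJ, Ψ.symm_J, Ψ.lift_apply]

theorem UnitaryIso.lift_metric (Ψ : UnitaryIso J J') (hΩ : IsSymplecticAction G Ω)
    (hJ : J'.IsEquivariant G) (h : G) (p : M) (u v : TangentSpace (𝓡 (2 * n)) p) :
    J.metric (h • p) (Ψ.lift h p u) (Ψ.lift h p v) = J.metric p u v := by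
  rw [J.metric_apply, ← Ψ.lift_J hJ, Ψ.lift_apply, Ψ.lift_apply, Ψ.symm_form, hΩ.preserves,
    Ψ.map_form, J.metric_apply]

/-- The lift of `h` to unitary frames, covering the action of `h` on `M`. -/
def UnitaryFrame.lift (Ψ : UnitaryIso J J') (hΩ : IsSymplecticAction G Ω)
    (hJ : J'.IsEquivariant G) (h : G) (f : UnitaryFrame J) : UnitaryFrame J where
  base := h • f.base
  u i := Ψ.lift h f.base (f.u i)
  v i := Ψ.lift h f.base (f.v i)
  v_eq i := by rw [f.v_eq, Ψ.lift_J hJ]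
  metric_uu i j := by rw [Ψ.lift_metric hΩ hJ, f.metric_uu]
  metric_uv i j := by rw [Ψ.lift_metric hΩ hJ, f.metric_uv]
  metric_vv i j := by rw [Ψ.lift_metric hΩ hJ, f.metric_vv]

theorem UnitaryFrame.lift_act (Ψ : UnitaryIso J J') (hΩ : IsSymplecticAction G Ω)
    (hJ : J'.IsEquivariant G) (h : G) (f : UnitaryFrame J)
    (C : Matrix.unitaryGroup (Fin n) ℂ) :
    (f.act C).lift Ψ hΩ hJ h = (f.lift Ψ hΩ hJ h).act C := by
  refine UnitaryFrame.ext_model rfl fun j => ?_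
  change Ψ.lift h f.base (∑ i, ((C.1 i j).re • f.u i + (C.1 i j).im • f.v i)) =
    ∑ i, ((C.1 i j).re • Ψ.lift h f.base (f.u i) + (C.1 i j).im • Ψ.lift h f.base (f.v i))
  simp only [map_sum, map_add, map_smul]

theorem UnitaryIso.conj_id (Ψ : UnitaryIso J J') (F : M → M) (hF : F = id) (p : M)
    (u : TangentSpace (𝓡 (2 * n)) p) :
    (show EuclideanSpace ℝ (Fin (2 * n)) from (Ψ.toEquiv (F p)).symm
      (mfderiv (𝓡 (2 * n)) (𝓡 (2 * n)) F p (Ψ.toEquiv p u))) = u := by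
  subst hF
  rw [mfderiv_id]
  exact (Ψ.toEquiv p).symm_apply_apply u

theorem UnitaryIso.conj_comp (Ψ : UnitaryIso J J') (F F₁ F₂ : M → M) (hF : F = F₁ ∘ F₂)
    (h₁ : MDifferentiable (𝓡 (2 * n)) (𝓡 (2 * n)) F₁)
    (h₂ : MDifferentiable (𝓡 (2 * n)) (𝓡 (2 * n)) F₂) (p : M)
    (u : TangentSpace (𝓡 (2 * n)) p) :
    (show EuclideanSpace ℝ (Fin (2 * n)) from (Ψ.toEquiv (F p)).symm
      (mfderiv (𝓡 (2 * n)) (𝓡 (2 * n)) F p (Ψ.toEquiv p u))) =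
    (show EuclideanSpace ℝ (Fin (2 * n)) from (Ψ.toEquiv (F₁ (F₂ p))).symm
      (mfderiv (𝓡 (2 * n)) (𝓡 (2 * n)) F₁ (F₂ p) (Ψ.toEquiv (F₂ p)
        ((Ψ.toEquiv (F₂ p)).symm
          (mfderiv (𝓡 (2 * n)) (𝓡 (2 * n)) F₂ p (Ψ.toEquiv p u)))))) := by
  subst hF
  rw [ContinuousLinearEquiv.apply_symm_apply, mfderiv_comp p (h₁ _) (h₂ _)]
  rfl

/-- The lifted action on the unitary frame bundle. -/
@[reducible]
def frameAction (Ψ : UnitaryIso J J') (hΩ : IsSymplecticAction G Ω)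
    (hJ : J'.IsEquivariant G) : MulAction G (UnitaryFrame J) where
  smul h f := f.lift Ψ hΩ hJ h
  one_smul f := UnitaryFrame.ext_model (one_smul G f.base) fun i =>
    Ψ.conj_id (fun x : M => (1 : G) • x) (funext (one_smul G)) f.base (f.u i)
  mul_smul h k f := UnitaryFrame.ext_model (mul_smul h k f.base) fun i =>
    Ψ.conj_comp (fun x : M => (h * k) • x) (fun x => h • x) (fun x => k • x)
      (funext (mul_smul h k)) ((hΩ.smooth h).mdifferentiable (by simp))
      ((hΩ.smooth k).mdifferentiable (by simp)) f.base (f.u i)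

/-- The induced action on `Γ_J`: `h · [f] = [h_# f]`. -/
@[reducible]
def gamAction (Ψ : UnitaryIso J J') (hΩ : IsSymplecticAction G Ω)
    (hJ : J'.IsEquivariant G) : MulAction G (Gam J) where
  smul h w := Quotient.map' (s₁ := suSetoid J) (s₂ := suSetoid J)
    (fun f => f.lift Ψ hΩ hJ h) (by
      rintro f _ ⟨C, hC, rfl⟩
      exact ⟨C, hC, UnitaryFrame.lift_act Ψ hΩ hJ h f C⟩) w
  one_smul w := by
    induction w using Quotient.inductionOn with
    | h f => exact congrArg (Gam.mk) ((frameAction Ψ hΩ hJ).one_smul f)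
  mul_smul h k w := by
    induction w using Quotient.inductionOn with
    | h f => exact congrArg (Gam.mk) ((frameAction Ψ hΩ hJ).mul_smul h k f)

end Action

end Symplectic

/-- A homomorphism from a closed subgroup `K` of a Lie group to the circle is a Lie group
homomorphism (for the embedded submanifold structure of `K`) iff near each point of `K` it is
the restriction of a smooth map defined on an open subset of the ambient group. -/
def IsLieHom {m : ℕ} {G : Type*} [TopologicalSpace G] [ChartedSpace (EuclideanSpace ℝ (Fin m)) G]
    [Group G] {K : Subgroup G} (φ : K →* Circle) : Prop :=
  ∀ k : K, ∃ U : Set G, IsOpen U ∧ (k : G) ∈ U ∧ ∃ F : G → Circle,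
    ContMDiffOn (𝓡 m) (𝓡 1) ∞ F U ∧ ∀ k' : K, (k' : G) ∈ U → F k' = φ k'

end Maslov

end

open Maslov

open scoped Manifold ContDiff

noncomputable section

namespace Maslov

/-! ### Hermitian linear algebra in the tangent spaces. -/

section Bundle

variable {n : ℕ} {M : Type*} [TopologicalSpace M]
  [ChartedSpace (EuclideanSpace ℝ (Fin (2 * n))) M] [IsManifold (𝓡 (2 * n)) ∞ M]
  {Ω : SymplecticForm n M} {J J' : CompatibleACS Ω}

/-! Each fibre of `Gam J` is a circle torsor. It is nonempty by a Hermitian Gram-Schmidt argument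
(`exists_unitaryFrame`). Since U(n) acts simply transitively on the unitary frames over a point
(`UnitaryFrame.exists_eq_act`, `UnitaryFrame.act_injective`), and the determinant identifies
U(n)/SU(n) with the circle, the circle acts freely and transitively on the fibre
(`Gam.circleAct_injective`, `Gam.exists_eq_circleAct`).

An element of G_p preserves the fibre over p and commutes with the circle, so it acts there as a
unique scalar, the same at every point because the circle is abelian. Uniqueness gives the
homomorphism property, the kernel and the conjugation invariance by short computations in the
torsor.

Smoothness needs a formula. The scalar of h is the complex determinant, in a frame at p, of the
derivative of h conjugated by Ψ (`eq_frameDet`). Read in the chart at p, this makes sense and is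
smooth for all h in an open neighbourhood of G_p in G (`contMDiffAt_chartPush`). Off G_p it is only
complex-valued; taking its argument gives local circle-valued extensions
(`isLieHom_of_contMDiffOn`). -/

instance finiteDimensional_tangentSpace (p : M) :
    FiniteDimensional ℝ (TangentSpace (𝓡 (2 * n)) p) :=
  inferInstanceAs (FiniteDimensional ℝ (EuclideanSpace ℝ (Fin (2 * n))))

omit [IsManifold (𝓡 (2 * n)) ∞ M] in
theorem finrank_tangentSpace (p : M) : Module.finrank ℝ (TangentSpace (𝓡 (2 * n)) p) = 2 * n :=
  finrank_euclideanSpace_fin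

theorem CompatibleACS.metric_J_right (J : CompatibleACS Ω) (p : M)
    (u v : TangentSpace (𝓡 (2 * n)) p) :
    J.metric p u (J.toMap p v) = - J.metric p (J.toMap p u) v := by
  rw [← J.metric_J_J p u, J.sq, map_neg]

theorem CompatibleACS.metric_J_self (J : CompatibleACS Ω) (p : M)
    (u : TangentSpace (𝓡 (2 * n)) p) : J.metric p u (J.toMap p u) = 0 := by
  have h := J.metric_J_right p u u
  rw [J.metric_symm p (J.toMap p u) u] at h
  linarith

/-- The tangent space contains `k ≤ n` vectors that are orthonormal for the Hermitian metric
defined by `J`. -/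
theorem CompatibleACS.exists_hermitian_orthonormal (J : CompatibleACS Ω) (p : M) (k : ℕ)
    (hk : k ≤ n) : ∃ u : Fin k → TangentSpace (𝓡 (2 * n)) p,
      (∀ i j, J.metric p (u i) (u j) = if i = j then 1 else 0) ∧
      ∀ i j, J.metric p (u i) (J.toMap p (u j)) = 0 := by
  induction k with
  | zero => exact ⟨Fin.elim0, fun i => i.elim0, fun i => i.elim0⟩
  | succ k ih =>
    obtain ⟨u, hu, huJ⟩ := ih (by omega)
    -- Hermitian orthogonality to the `k` earlier vectors is `2 * k` real equations on a space of
    -- dimension `2 * n > 2 * k`, so a nonzero solution `x` exists; `c` normalizes it.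
    let T : TangentSpace (𝓡 (2 * n)) p →ₗ[ℝ] (Fin k → ℝ) × (Fin k → ℝ) :=
      (LinearMap.pi fun i => J.metric p (u i)).prod
        (LinearMap.pi fun i => J.metric p (J.toMap p (u i)))
    have hT : LinearMap.ker T ≠ ⊥ := LinearMap.ker_ne_bot_of_finrank_lt (by
      rw [finrank_tangentSpace, Module.finrank_prod, Module.finrank_fin_fun]; omega)
    obtain ⟨x, hxT, hx0⟩ := Submodule.exists_mem_ne_zero_of_ne_bot hT
    have hx1 : ∀ i, J.metric p (u i) x = 0 := fun i =>
      congrFun (congrArg Prod.fst (LinearMap.mem_ker.1 hxT)) i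
    have hx2 : ∀ i, J.metric p (J.toMap p (u i)) x = 0 := fun i =>
      congrFun (congrArg Prod.snd (LinearMap.mem_ker.1 hxT)) i
    have hpos : 0 < J.metric p x x := J.pos p x hx0
    let c : ℝ := (Real.sqrt (J.metric p x x))⁻¹
    have hc : c * (c * J.metric p x x) = 1 := by
      have h := Real.mul_self_sqrt hpos.le
      have h0 := (Real.sqrt_pos.2 hpos).ne'
      simp only [c]
      field_simp
      exact h.symm.trans (_root_.sq _).symm
    refine ⟨Fin.snoc (α := fun _ => TangentSpace (𝓡 (2 * n)) p) u (c • x), ?_, ?_⟩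
    · intro i j
      induction i using Fin.lastCases with
      | last =>
        induction j using Fin.lastCases with
        | last => simpa using hc
        | cast j => simp [J.metric_symm p x, hx1, (Fin.castSucc_lt_last j).ne']
      | cast i =>
        induction j using Fin.lastCases with
        | last => simp [hx1, (Fin.castSucc_lt_last i).ne]
        | cast j => simp [hu]
    · intro i j
      induction i using Fin.lastCases with
      | last =>
        induction j using Fin.lastCases with
        | last => simp [J.metric_J_self]
        | cast j => simp [J.metric_symm p x, hx2]
      | cast i =>
        induction j using Fin.lastCases with
        | last => simp [J.metric_J_right, hx2]
        | cast j => simp [huJ]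

theorem exists_unitaryFrame (J : CompatibleACS Ω) (p : M) :
    ∃ f : UnitaryFrame J, f.base = p := by
  obtain ⟨u, hu, huJ⟩ := J.exists_hermitian_orthonormal p n le_rfl
  exact ⟨⟨p, u, fun i => J.toMap p (u i), fun _ => rfl, hu, huJ,
    fun i j => (J.metric_J_J p _ _).trans (hu i j)⟩, rfl⟩

theorem Gam.exists_proj_eq (J : CompatibleACS Ω) (p : M) : ∃ w : Gam J, w.proj = p :=
  let ⟨f, hf⟩ := exists_unitaryFrame J p
  ⟨Gam.mk f, hf⟩

/-- The real and imaginary parts of the complex coordinates of a tangent vector in a frame. -/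
def UnitaryFrame.realCoeff (f : UnitaryFrame J) :
    TangentSpace (𝓡 (2 * n)) f.base →ₗ[ℝ] (Fin n → ℝ) × (Fin n → ℝ) :=
  (LinearMap.pi fun i => J.metric f.base (f.u i)).prod
    (LinearMap.pi fun i => J.metric f.base (f.v i))

theorem UnitaryFrame.realCoeff_sum (f : UnitaryFrame J) (a b : Fin n → ℝ) :
    f.realCoeff (∑ i, (a i • f.u i + b i • f.v i)) = (a, b) := by
  have hvu : ∀ i j, J.metric f.base (f.v i) (f.u j) = 0 := fun i j => by
    rw [J.metric_symm, f.metric_uv]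
  refine Prod.ext (funext fun j => ?_) (funext fun j => ?_)
  · change J.metric f.base (f.u j) _ = a j
    simp [f.metric_uu, f.metric_uv]
  · change J.metric f.base (f.v j) _ = b j
    simp [f.metric_vv, hvu]

/-- `realCoeff_sum` gives surjectivity, and both sides have real dimension `2 * n`. -/
theorem UnitaryFrame.realCoeff_injective (f : UnitaryFrame J) :
    Function.Injective f.realCoeff :=
  (LinearMap.injective_iff_surjective_of_finrank_eq_finrank (by
    rw [finrank_tangentSpace, Module.finrank_prod, Module.finrank_fin_fun]; omega)).2
    fun ab => ⟨_, f.realCoeff_sum ab.1 ab.2⟩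

/-- A tangent vector expanded in a unitary frame. -/
theorem UnitaryFrame.sum_realCoeff (f : UnitaryFrame J) (x : TangentSpace (𝓡 (2 * n)) f.base) :
    ∑ i, (J.metric f.base (f.u i) x • f.u i + J.metric f.base (f.v i) x • f.v i) = x :=
  f.realCoeff_injective (f.realCoeff_sum _ _)

/-- The matrix of complex coordinates of a family of tangent vectors in a unitary frame. -/
def UnitaryFrame.coeffMatrix (f : UnitaryFrame J)
    (x : Fin n → TangentSpace (𝓡 (2 * n)) f.base) : Matrix (Fin n) (Fin n) ℂ :=
  Matrix.of fun i j => ⟨J.metric f.base (f.u i) (x j), J.metric f.base (f.v i) (x j)⟩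

theorem UnitaryFrame.coeffMatrix_act (f : UnitaryFrame J) (C : Matrix.unitaryGroup (Fin n) ℂ) :
    f.coeffMatrix (f.act C).u = C.1 := by
  ext i j
  have h := f.realCoeff_sum (fun i => (C.1 i j).re) (fun i => (C.1 i j).im)
  exact Complex.ext (congrFun (congrArg Prod.fst h) i) (congrFun (congrArg Prod.snd h) i)

/-- The complex coordinates of a Hermitian orthonormal family form a unitary matrix. -/
theorem UnitaryFrame.coeffMatrix_mem (f : UnitaryFrame J)
    (x : Fin n → TangentSpace (𝓡 (2 * n)) f.base)
    (hx : ∀ i j, J.metric f.base (x i) (x j) = if i = j then 1 else 0)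
    (hxJ : ∀ i j, J.metric f.base (x i) (J.toMap f.base (x j)) = 0) :
    f.coeffMatrix x ∈ Matrix.unitaryGroup (Fin n) ℂ := by
  -- In complex coordinates `J` is multiplication by i: a + ib becomes -b + ia.
  have hJx : ∀ j, J.toMap f.base (x j) = ∑ i, (-J.metric f.base (f.v i) (x j) • f.u i +
      J.metric f.base (f.u i) (x j) • f.v i) := fun j => by
    conv_lhs => rw [← f.sum_realCoeff (x j)]
    simp only [map_sum, map_add, map_smul, f.v_eq, J.sq]
    refine Finset.sum_congr rfl fun i _ => ?_
    module
  rw [Matrix.mem_unitaryGroup_iff']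
  ext j l
  -- `h1` is the real part of the (j, l) entry of C*C. The imaginary part is `h2`, with the indices
  -- exchanged so that the sign agrees.
  have h1 := hx j l
  rw [← f.sum_realCoeff (x j), ← f.sum_realCoeff (x l), f.metric_sum] at h1
  have h2 := hxJ l j
  rw [hJx, ← f.sum_realCoeff (x l), f.metric_sum] at h2
  apply Complex.ext
  · simpa [Matrix.mul_apply, Matrix.one_apply, Matrix.star_apply, apply_ite Complex.re,
      UnitaryFrame.coeffMatrix] using h1
  · simp only [Matrix.mul_apply, Matrix.one_apply, Matrix.star_apply, apply_ite Complex.im,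
      UnitaryFrame.coeffMatrix, Complex.im_sum, Matrix.of_apply, Complex.one_im, Complex.zero_im,
      ite_self, RCLike.star_def, Complex.mul_im, Complex.conj_re, Complex.conj_im]
    rw [← h2]
    exact Finset.sum_congr rfl fun i _ => by ring

/-- Two unitary frames over the same point differ by the unitary matrix of coordinates. -/
theorem UnitaryFrame.exists_eq_act (f f' : UnitaryFrame J) (hb : f'.base = f.base) :
    ∃ C : Matrix.unitaryGroup (Fin n) ℂ,
      C.1 = f.coeffMatrix (fun j => (show EuclideanSpace ℝ (Fin (2 * n)) from f'.u j)) ∧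
      f' = f.act C := by
  obtain ⟨b', u', v', hv', huu', huv', hvv'⟩ := f'
  obtain rfl : b' = f.base := hb
  obtain rfl : v' = fun i => J.toMap f.base (u' i) := funext hv'
  refine ⟨⟨f.coeffMatrix u', f.coeffMatrix_mem u' huu' huv'⟩, rfl, ?_⟩
  exact UnitaryFrame.ext_model rfl fun j => (f.sum_realCoeff (u' j)).symm

theorem UnitaryFrame.act_injective (f : UnitaryFrame J) : Function.Injective f.act := by
  intro C D h
  apply Subtype.ext
  -- The base point of `f.act C` is buried in its type, so the equation is stated for a variable
  -- frame with vectors read in the model space; it can then be substituted.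
  have key : ∀ f' : UnitaryFrame J, f' = f.act D →
      f.coeffMatrix (fun j => (show EuclideanSpace ℝ (Fin (2 * n)) from f'.u j)) = D.1 := by
    rintro _ rfl
    exact f.coeffMatrix_act D
  exact (f.coeffMatrix_act C).symm.trans (key _ h)

/-! ### The fibres as circle torsors. -/

theorem Gam.circleAct_mul [NeZero n] (w : Gam J) (a b : Circle) :
    w.circleAct (a * b) = (w.circleAct a).circleAct b := by
  induction w using Quotient.inductionOn with
  | h f =>
    change Gam.mk _ = Gam.mk ((f.act (circleUnitary a)).act (circleUnitary b))
    rw [← UnitaryFrame.act_mul]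
    refine Gam.mk_eq_of_det_eq f ?_
    change _ = ((circleUnitary (n := n) a).1 * (circleUnitary (n := n) b).1).det
    rw [Matrix.det_mul, det_circleUnitary, det_circleUnitary, det_circleUnitary, Circle.coe_mul]

theorem Gam.circleAct_one [NeZero n] (w : Gam J) : w.circleAct 1 = w := by
  induction w using Quotient.inductionOn with
  | h f =>
    refine (Gam.circleAct_mk f 1 1 (by simp)).trans ?_
    rw [f.act_one]
    rfl

/-- If two multiples of [f] agree, the representing unitary matrices differ by an element of SU(n),
because U(n) acts freely on frames; hence their determinants agree. -/
theorem Gam.circleAct_injective [NeZero n] (w : Gam J) : Function.Injective w.circleAct := by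
  intro a b h
  induction w using Quotient.inductionOn with
  | h f =>
    obtain ⟨S, hS, h⟩ := Quotient.exact (s := suSetoid J) h
    rw [← UnitaryFrame.act_mul] at h
    have hd := congrArg (fun C : Matrix.unitaryGroup (Fin n) ℂ => C.1.det) (f.act_injective h)
    change (circleUnitary (n := n) b).1.det = ((circleUnitary (n := n) a).1 * S.1).det at hd
    rw [Matrix.det_mul, (Matrix.mem_specialUnitaryGroup_iff.1 hS).2, mul_one, det_circleUnitary,
      det_circleUnitary] at hd
    exact (Circle.ext hd).symm

theorem exists_circle_eq_det (C : Matrix.unitaryGroup (Fin n) ℂ) :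
    ∃ z : Circle, C.1.det = z :=
  ⟨⟨C.1.det, mem_sphere_zero_iff_norm.2
    (CStarRing.norm_of_mem_unitary (Matrix.det_of_mem_unitary C.2))⟩, rfl⟩

theorem Gam.exists_eq_circleAct [NeZero n] (w w' : Gam J) (h : w'.proj = w.proj) :
    ∃ z : Circle, w' = w.circleAct z := by
  induction w using Quotient.inductionOn with
  | h f =>
    induction w' using Quotient.inductionOn with
    | h f' =>
      obtain ⟨C, -, rfl⟩ := f.exists_eq_act f' h
      obtain ⟨z, hz⟩ := exists_circle_eq_det C
      exact ⟨z, (Gam.circleAct_mk f z C hz).symm⟩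

/-! ### The isotropy homomorphisms. -/

section Action

variable {G : Type*} [Group G] [MulAction G M] (Ψ : UnitaryIso J J')
  (hΩ : IsSymplecticAction G Ω) (hJ : J'.IsEquivariant G)

theorem gamAction_proj (h : G) (w : Gam J) :
    letI := gamAction Ψ hΩ hJ
    (h • w).proj = h • w.proj := by
  induction w using Quotient.inductionOn with
  | h f => rfl

theorem gamAction_circleAct [NeZero n] (h : G) (w : Gam J) (z : Circle) :
    letI := gamAction Ψ hΩ hJ
    h • w.circleAct z = (h • w).circleAct z := by
  induction w using Quotient.inductionOn with
  | h f => exact congrArg Gam.mk (UnitaryFrame.lift_act Ψ hΩ hJ h f (circleUnitary z))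

/-- The isotropy group of `p` acts on the fibre over `p` of the Maslov circle bundle through a
homomorphism to the circle. -/
theorem exists_isotropy_hom [NeZero n] (p : M) :
    letI := gamAction Ψ hΩ hJ
    ∃ φ : MulAction.stabilizer G p →* Circle, ∀ w : Gam J, w.proj = p →
      ∀ h : MulAction.stabilizer G p, (h : G) • w = w.circleAct (φ h) := by
  let _ := gamAction Ψ hΩ hJ
  obtain ⟨w, hw⟩ := Gam.exists_proj_eq J p
  have hex : ∀ h : MulAction.stabilizer G p, ∃ z : Circle, (h : G) • w = w.circleAct z :=
    fun h => Gam.exists_eq_circleAct _ _ (by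
      rw [gamAction_proj, hw]; exact h.2)
  choose φ hφ using hex
  -- By freeness it is enough to compare after acting on the one chosen `w`: w·φ(ab) = a(bw) =
  -- a(w·φ(b)) = (aw)·φ(b) = w·φ(a)φ(b).
  refine ⟨MonoidHom.mk' φ fun a b => w.circleAct_injective ?_, fun w' hw' h => ?_⟩
  · rw [← hφ, Gam.circleAct_mul, ← hφ a, ← gamAction_circleAct, ← hφ b]
    exact mul_smul (a : G) (b : G) w
  -- Any other point of the fibre is w·z, and h(w·z) = w·φ(h)z = (w·z)·φ(h) as the circle is
  -- commutative.
  · obtain ⟨z, rfl⟩ := Gam.exists_eq_circleAct w w' (hw'.trans hw.symm)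
    change _ = (w.circleAct z).circleAct (φ h)
    rw [gamAction_circleAct, hφ, ← Gam.circleAct_mul, ← Gam.circleAct_mul, mul_comm]

end Action

end Bundle

/-! ### Smoothness through a determinant formula. -/

section Smoothness

variable {n : ℕ} {M : Type*} [TopologicalSpace M]
  [ChartedSpace (EuclideanSpace ℝ (Fin (2 * n))) M] [IsManifold (𝓡 (2 * n)) ∞ M]
  {Ω : SymplecticForm n M} {J J' : CompatibleACS Ω} {m : ℕ}
  {G : Type*} [TopologicalSpace G] [ChartedSpace (EuclideanSpace ℝ (Fin m)) G] [Group G]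
  [MulAction G M]

variable (n) in
/-- The action of `h` in the preferred chart around `p`. -/
def chartAction (p : M) (h : G) (y : EuclideanSpace ℝ (Fin (2 * n))) :
    EuclideanSpace ℝ (Fin (2 * n)) :=
  extChartAt (𝓡 (2 * n)) p (h • (extChartAt (𝓡 (2 * n)) p).symm y)

variable (n) in
/-- The derivative at `p` of the action of `h`, in the preferred chart around `p`. -/
def chartPush (p : M) (h : G) :
    EuclideanSpace ℝ (Fin (2 * n)) →L[ℝ] EuclideanSpace ℝ (Fin (2 * n)) :=
  fderiv ℝ (chartAction n p h) (extChartAt (𝓡 (2 * n)) p p)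

/-- The action is jointly smooth in (h, y), so its partial derivative in y at a fixed point is
smooth in h. Only h·p in the chart domain is assumed, not h·p = p, so that the result holds on an
open subset of G. -/
theorem contMDiffAt_chartPush [IsManifold (𝓡 m) 1 G] [ContMDiffSMul (𝓡 m) (𝓡 (2 * n)) ∞ G M] (p : M) (h : G)
    (hh : h • p ∈ (chartAt (EuclideanSpace ℝ (Fin (2 * n))) p).source) :
    ContMDiffAt (𝓡 m) 𝓘(ℝ, EuclideanSpace ℝ (Fin (2 * n)) →L[ℝ] EuclideanSpace ℝ (Fin (2 * n)))
      ∞ (chartPush (G := G) n p) h := by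
  have hsymm : ContMDiffAt 𝓘(ℝ, EuclideanSpace ℝ (Fin (2 * n))) (𝓡 (2 * n)) ∞
      (extChartAt (𝓡 (2 * n)) p).symm (extChartAt (𝓡 (2 * n)) p p) :=
    (contMDiffOn_extChartAt_symm p).contMDiffAt (extChartAt_target_mem_nhds p)
  have hsmul : ContMDiffAt ((𝓡 m).prod 𝓘(ℝ, EuclideanSpace ℝ (Fin (2 * n)))) (𝓡 (2 * n)) ∞
      (fun x : G × EuclideanSpace ℝ (Fin (2 * n)) => x.1 • (extChartAt (𝓡 (2 * n)) p).symm x.2)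
      (h, extChartAt (𝓡 (2 * n)) p p) :=
    contMDiffAt_fst.smul (hsymm.comp (h, extChartAt (𝓡 (2 * n)) p p) contMDiffAt_snd)
  have hf : ContMDiffAt ((𝓡 m).prod 𝓘(ℝ, EuclideanSpace ℝ (Fin (2 * n))))
      𝓘(ℝ, EuclideanSpace ℝ (Fin (2 * n))) ∞ (Function.uncurry (chartAction (G := G) n p))
      (h, extChartAt (𝓡 (2 * n)) p p) := by
    refine ContMDiffAt.comp (h, extChartAt (𝓡 (2 * n)) p p) (contMDiffAt_extChartAt' ?_) hsmul
    simpa using hh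
  have key := hf.mfderiv (chartAction (G := G) n p) (fun _ => extChartAt (𝓡 (2 * n)) p p)
    contMDiffAt_const (m := ∞) (by simp)
  have hpush : chartPush (G := G) n p =
      fun g => mfderiv (𝓡 (2 * n)) (𝓡 (2 * n)) (chartAction n p g)
        (extChartAt (𝓡 (2 * n)) p p) := funext fun g => mfderiv_eq_fderiv.symm
  -- `key` is phrased in tangent coordinates, which are trivial on a model vector space.
  have hcoord := inTangentCoordinates_model_space (I := 𝓡 (2 * n)) (I' := 𝓡 (2 * n))
    (fun _ : G => extChartAt (𝓡 (2 * n)) p p)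
    (fun g : G => chartAction n p g (extChartAt (𝓡 (2 * n)) p p)) (chartPush n p) h
  rw [← hcoord, hpush]
  exact key

-- The manifold derivative uses the preferred charts at p and at h·p; on the isotropy group these
-- coincide.
omit [IsManifold (𝓡 (2 * n)) ∞ M] [TopologicalSpace G] in
theorem push_eq_chartPush (hΩ : IsSymplecticAction G Ω) (p : M) (h : G) (hp : h • p = p) :
    (show EuclideanSpace ℝ (Fin (2 * n)) →L[ℝ] EuclideanSpace ℝ (Fin (2 * n)) from push n h p) =
      chartPush n p h := by
  have hd : MDifferentiableAt (𝓡 (2 * n)) (𝓡 (2 * n)) (fun x : M => h • x) p :=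
    (hΩ.smooth h).mdifferentiable (by simp) p
  change mfderiv (𝓡 (2 * n)) (𝓡 (2 * n)) (fun x : M => h • x) p = _
  rw [hd.mfderiv]
  simp only [modelWithCornersSelf_coe, Set.range_id, fderivWithin_univ]
  simp only [writtenInExtChartAt, hp]
  rfl

/-- The complex determinant, in the frame `f`, of a linear endomorphism conjugated by `Ψ`. -/
def frameDet (Ψ : UnitaryIso J J') (f : UnitaryFrame J)
    (A : EuclideanSpace ℝ (Fin (2 * n)) →L[ℝ] EuclideanSpace ℝ (Fin (2 * n))) : ℂ :=
  (f.coeffMatrix fun j => (Ψ.toEquiv f.base).symm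
    (show EuclideanSpace ℝ (Fin (2 * n)) from A (Ψ.toEquiv f.base (f.u j)))).det

/-- The matrix entries are real-linear in `A`, and the determinant is polynomial in them. -/
theorem contDiff_frameDet (Ψ : UnitaryIso J J') (f : UnitaryFrame J) :
    ContDiff ℝ ∞ (frameDet Ψ f) := by
  have hlin : ∀ (B : TangentSpace (𝓡 (2 * n)) f.base →ₗ[ℝ] ℝ) (j : Fin n), ContDiff ℝ ∞
      fun A : EuclideanSpace ℝ (Fin (2 * n)) →L[ℝ] EuclideanSpace ℝ (Fin (2 * n)) =>
        B ((Ψ.toEquiv f.base).symm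
          (show EuclideanSpace ℝ (Fin (2 * n)) from A (Ψ.toEquiv f.base (f.u j)))) := by
    intro B j
    let B' : EuclideanSpace ℝ (Fin (2 * n)) →ₗ[ℝ] ℝ :=
      B.comp (Ψ.toEquiv f.base).symm.toLinearEquiv.toLinearMap
    let x : EuclideanSpace ℝ (Fin (2 * n)) := Ψ.toEquiv f.base (f.u j)
    exact (LinearMap.toContinuousLinearMap B').contDiff.comp
      (contDiff_id.clm_apply (contDiff_const (c := x)))
  unfold frameDet
  simp only [Matrix.det_apply]
  refine ContDiff.sum fun σ _ => ContDiff.const_smul _ (contDiff_prod fun i _ => ?_)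
  simp only [UnitaryFrame.coeffMatrix, Matrix.of_apply]
  exact Complex.equivRealProdCLM.symm.contDiff.comp ((hlin _ _).prodMk (hlin _ _))

-- The lifted frame is f·C with C its coordinate matrix in f, so h[f] = [f]·det C, and freeness
-- identifies `z` with det C.
omit [TopologicalSpace G] in
theorem eq_frameDet [NeZero n] (Ψ : UnitaryIso J J') (hΩ : IsSymplecticAction G Ω)
    (hJ : J'.IsEquivariant G) (f : UnitaryFrame J) (h : G) (hp : h • f.base = f.base)
    (z : Circle)
    (hz : letI := gamAction Ψ hΩ hJ; h • Gam.mk f = (Gam.mk f).circleAct z) :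
    frameDet Ψ f (chartPush n f.base h) = z := by
  obtain ⟨C, hC, hCf⟩ := f.exists_eq_act (f.lift Ψ hΩ hJ h) hp
  obtain ⟨z', hz'⟩ := exists_circle_eq_det C
  have hzz : z = z' := (Gam.mk f).circleAct_injective (by
    rw [← hz, Gam.circleAct_mk f z' C hz', ← hCf]; rfl)
  rw [hzz, ← hz', hC]
  unfold frameDet
  congr 2
  funext j
  rw [← push_eq_chartPush hΩ f.base h hp]
  change _ = (show EuclideanSpace ℝ (Fin (2 * n)) from
    (Ψ.toEquiv (h • f.base)).symm (push n h f.base (Ψ.toEquiv f.base (f.u j))))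
  rw [hp]
  rfl

/-- A homomorphism to the circle that is near each point the restriction of a smooth complex
function is a Lie group homomorphism. -/
theorem isLieHom_of_contMDiffOn {K : Subgroup G} (φ : K →* Circle) (U : Set G) (hU : IsOpen U)
    (hKU : (K : Set G) ⊆ U) (D : G → ℂ) (hD : ContMDiffOn (𝓡 m) 𝓘(ℝ, ℂ) ∞ D U)
    (hφ : ∀ k : K, D k = φ k) : IsLieHom (m := m) φ := by
  intro k
  -- Dividing by φ(k) moves the value at `k` to 1, inside the slit plane where the logarithm is
  -- smooth. The imaginary part of the logarithm is the argument, so its exponential lies on the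
  -- circle even where `D` does not.
  have hD' : ContMDiffOn (𝓡 m) 𝓘(ℝ, ℂ) ∞ (fun h => D h * ((φ k)⁻¹ : Circle)) U :=
    (contDiff_id.mul contDiff_const : ContDiff ℝ ∞
      fun z : ℂ => z * ((φ k)⁻¹ : Circle)).contMDiff.comp_contMDiffOn hD
  refine ⟨U ∩ (fun h => D h * ((φ k)⁻¹ : Circle)) ⁻¹' Complex.slitPlane,
    hD'.continuousOn.isOpen_inter_preimage hU Complex.isOpen_slitPlane, ⟨hKU k.2, ?_⟩,
    fun h => φ k * Circle.exp (Complex.log (D h * ((φ k)⁻¹ : Circle))).im, ?_, ?_⟩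
  · simp [hφ]
  · have hlog : ContMDiffOn 𝓘(ℝ, ℂ) 𝓘(ℝ, ℝ) ∞ (fun z => (Complex.log z).im)
        Complex.slitPlane := fun z hz =>
      (Complex.imCLM.contDiff.contDiffAt.comp z
        ((Complex.contDiffAt_log hz).restrict_scalars ℝ)).contMDiffAt.contMDiffWithinAt
    have hexp : ContMDiff 𝓘(ℝ, ℝ) (𝓡 1) ∞ Circle.exp := contMDiff_circleExp
    exact contMDiffOn_const.mul (hexp.comp_contMDiffOn
      (hlog.comp (hD'.mono Set.inter_subset_left) fun h hh => hh.2))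
  · intro k' _
    have : D k' * ((φ k)⁻¹ : Circle) = ((φ k' * (φ k)⁻¹ : Circle) : ℂ) := by
      rw [hφ, Circle.coe_mul]
    simp only [this, Complex.log_im, Circle.exp_arg]
    rw [mul_comm (φ k'), mul_inv_cancel_left]

end Smoothness

end Maslov

end

open Maslov
theorem mainTheorem4 {n : ℕ} [NeZero n] {m : ℕ}
    {M : Type*} [TopologicalSpace M] [T2Space M] [SecondCountableTopology M]
    [ChartedSpace (EuclideanSpace ℝ (Fin (2 * n))) M] [IsManifold (𝓡 (2 * n)) ∞ M]
    (Ω : SymplecticForm n M)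
    {G : Type*} [TopologicalSpace G] [T2Space G] [CompactSpace G]
    [ChartedSpace (EuclideanSpace ℝ (Fin m)) G] [Group G] [LieGroup (𝓡 m) ∞ G]
    [MulAction G M] [ContMDiffSMul (𝓡 m) (𝓡 (2 * n)) ∞ G M]
    (hΩ : IsSymplecticAction G Ω)
    (J J' : CompatibleACS Ω) (hJ' : J'.IsEquivariant G) (Ψ : UnitaryIso J J') :
    letI : MulAction G (Gam J) := gamAction Ψ hΩ hJ'
    ∃ φ : ∀ p : M, MulAction.stabilizer G p →* Circle,
      (∀ p : M, IsClosed (MulAction.stabilizer G p : Set G) ∧ IsLieHom (m := m) (φ p)) ∧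
      (∀ (p : M) (w : Gam J), w.proj = p →
        (∀ h : MulAction.stabilizer G p, (h : G) • w = w.circleAct (φ p h)) ∧
        (φ p).ker.map (MulAction.stabilizer G p).subtype = MulAction.stabilizer G w) ∧
      (∀ (p : M) (h' : G),
        (φ (h' • p)).comp
          (MulAction.stabilizerEquivStabilizer (g := h') (a := p) rfl).toMonoidHom = φ p) := by
  let _ : MulAction G (Gam J) := gamAction Ψ hΩ hJ'
  have : ContinuousSMul G M :=
    ContMDiffSMul.continuousSMul (I := 𝓡 m) (I' := 𝓡 (2 * n)) ∞
  have hcont : ∀ p : M, Continuous fun h : G => h • p := fun p =>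
    continuous_id.smul continuous_const
  choose φ hφ using exists_isotropy_hom (G := G) Ψ hΩ hJ'
  refine ⟨φ, fun p => ⟨isClosed_singleton.preimage (hcont p), ?_⟩,
    fun p w hw => ⟨hφ p w hw, ?_⟩, fun p h' => ?_⟩
  · obtain ⟨f, rfl⟩ := exists_unitaryFrame J p
    refine isLieHom_of_contMDiffOn (φ f.base)
      ((fun h : G => h • f.base) ⁻¹' (chartAt (EuclideanSpace ℝ (Fin (2 * n))) f.base).source)
      ((chartAt _ f.base).open_source.preimage (hcont f.base)) (fun h hh => ?_)
      (fun h => frameDet Ψ f (chartPush n f.base h)) (fun h hh => ?_) fun h => ?_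
    · have hh' : h • f.base = f.base := hh
      rw [Set.mem_preimage, hh']
      exact mem_chart_source _ _
    · exact ((contDiff_frameDet Ψ f).contDiffAt.comp_contMDiffAt
        (contMDiffAt_chartPush f.base h hh)).contMDiffWithinAt
    · exact eq_frameDet Ψ hΩ hJ' f h h.2 _ (hφ f.base (Gam.mk f) rfl h)
  · ext h
    simp only [Subgroup.mem_map, MonoidHom.mem_ker, Subgroup.coe_subtype,
      MulAction.mem_stabilizer_iff]
    constructor
    · rintro ⟨k, hk, rfl⟩
      rw [hφ p w hw, hk, w.circleAct_one]
    -- Fixing `w` forces fixing its projection, so G_w lies in G_p.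
    · intro hh
      have hp : h • p = p := by
        rw [← hw, ← gamAction_proj Ψ hΩ hJ', hh]
      refine ⟨⟨h, hp⟩, w.circleAct_injective ?_, rfl⟩
      rw [← hφ p w hw, w.circleAct_one]
      exact hh
  · ext h : 1
    obtain ⟨w, hw⟩ := Gam.exists_proj_eq J p
    have hw' : (h' • w).proj = h' • p := by rw [gamAction_proj, hw]
    -- At h'w, over h'·p: (h'w)·φ(h'hh'⁻¹) = h'hh'⁻¹h'w = h'(hw) = h'(w·φ(h)) = (h'w)·φ(h), with φ
    -- taken at h'·p on the left and at p on the right.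
    refine (h' • w).circleAct_injective ?_
    change (h' • w).circleAct (φ (h' • p)
      (MulAction.stabilizerEquivStabilizer (g := h') (a := p) rfl h)) = _
    rw [← hφ _ _ hw', ← gamAction_circleAct, ← hφ p w hw, ← mul_smul, ← mul_smul]
    congr 1
    simp [MulAction.stabilizerEquivStabilizer_apply]
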